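/- Let $\Delta$ be a countable compact subset of $\mathbb{R}$. Put $\Delta^{(1)}$ for the set of limit points of $\Delta$, let $\Delta^{(n+1)}$ be the set of limit points of $\Delta^{(n)}$ for $n\ge 1$, and let $\Delta^{(\infty)}=\bigcap_{n\ge 1}\Delta^{(n)}$. Let $\mathbf{Z}[\mathbb{R}]$ be the family of zero sets of continuous functions on $\mathbb{R}$. A $z$-filter on $\mathbb{R}$ is a non-empty proper subset of $\mathbf{Z}[\mathbb{R}]$ that is closed under finite intersections and under supersets in $\mathbf{Z}[\mathbb{R}]$; it is a prime $z$-filter $\mathcal{P}$ if moreover $Z_1\cup Z_2\notin\mathcal{P}$ whenever $Z_1,Z_2\in\mathbf{Z}[\mathbb{R}]\setminus\mathcal{P}$. Let $\mathfrak{c}=2^{\aleph_0}$, identified with the smallest ordinal of that cardinality. Suppose that $\Delta^{(\infty)}\neq\emptyset$. Then: 1. there is a well-ordered decreasing chain of order type $\mathfrak{c}$ of prime $z$-filters on $\mathbb{R}$, each of which contains $\Delta$; that is, there is a family $(\mathcal{Q}_\alpha)_{\alpha<\mathfrak{c}}$ of prime $z$-filters on $\mathbb{R}$ with $\Delta\in\mathcal{Q}_\alpha$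 for every $\alpha<\mathfrak{c}$ and $\mathcal{Q}_\beta\subsetneq\mathcal{Q}_\alpha$ whenever $\alpha<\beta<\mathfrak{c}$; 2. there is a well-ordered increasing chain of order type $\mathfrak{c}$ of prime $z$-filters on $\mathbb{R}$, each of which contains $\Delta$; that is, there is a family $(\mathcal{Q}_\alpha)_{\alpha<\mathfrak{c}}$ of prime $z$-filters on $\mathbb{R}$ with $\Delta\in\mathcal{Q}_\alpha$ for every $\alpha<\mathfrak{c}$ and $\mathcal{Q}_\alpha\subsetneq\mathcal{Q}_\beta$ whenever $\alpha<\beta<\mathfrak{c}$. -/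

import Mathlib

/-- The family `Z[X]` of all zero sets of continuous real-valued functions on `X`. -/
def zeroSets (X : Type*) [TopologicalSpace X] : Set (Set X) :=
  {Z | ∃ f : C(X, ℝ), Z = {x | f x = 0}}

/-- A `z`-filter on `X`: a non-empty proper subset of `Z[X]` which is closed under finite
intersections and under supersets in `Z[X]`. -/
structure IsZFilter {X : Type*} [TopologicalSpace X] (F : Set (Set X)) : Prop where
  nonempty : F.Nonempty
  proper : F ⊂ zeroSets X
  inter_mem : ∀ Z₁ ∈ F, ∀ Z₂ ∈ F, Z₁ ∩ Z₂ ∈ F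
  superset_mem : ∀ Z₁ ∈ F, ∀ Z₂ ∈ zeroSets X, Z₁ ⊆ Z₂ → Z₂ ∈ F

/-- A prime `z`-filter: a `z`-filter `P` such that `Z₁ ∪ Z₂ ∉ P` whenever `Z₁` and `Z₂` are
zero sets not in `P`. -/
structure IsPrimeZFilter {X : Type*} [TopologicalSpace X] (P : Set (Set X)) : Prop
    extends IsZFilter P where
  union_notMem : ∀ Z₁ ∈ zeroSets X \ P, ∀ Z₂ ∈ zeroSets X \ P, Z₁ ∪ Z₂ ∉ P

/-- `A^{(∞)} = ⋂_{n ≥ 1} A^{(n)}`, where `A^{(1)}` is the set of limit points of the subspace `A`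
and `A^{(n+1)}` is the set of limit points of the subspace `A^{(n)}`. -/
def derivedLevelInfty {X : Type*} [TopologicalSpace X] (A : Set X) : Set X :=
  ⋂ n : ℕ, CantorBendixson.iteratedDerivedSet A ((n + 1 : ℕ) : Ordinal)

/-- `(Q_α : α < κ)` is a well-ordered decreasing chain of order type `κ` of prime `z`-filters
on `X`: it is strictly decreasing with respect to inclusion. -/
def IsDecreasingPrimeZChain {X : Type*} [TopologicalSpace X] {κ : Ordinal}
    (Q : Set.Iio κ → Set (Set X)) : Prop :=
  (∀ α, IsPrimeZFilter (Q α)) ∧ ∀ α β, α < β → Q β ⊂ Q α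

/-- `(Q_α : α < κ)` is a well-ordered increasing chain of order type `κ` of prime `z`-filters
on `X`: it is strictly increasing with respect to inclusion. -/
def IsIncreasingPrimeZChain {X : Type*} [TopologicalSpace X] {κ : Ordinal}
    (Q : Set.Iio κ → Set (Set X)) : Prop :=
  (∀ α, IsPrimeZFilter (Q α)) ∧ ∀ α β, α < β → Q α ⊂ Q β

/-!
A point of `A^{(n)}` lies at the top of a strictly decreasing chain of `n + 1` prime `z`-filters
containing `A`. For `n + 1`, choose pairwise disjoint closed neighbourhoods `B k` of points of
`A^{(n)}` that shrink to the given point `p` of `A^{(n+1)}`, take a chain for each `k`, pass to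
the limit of these chains along a free ultrafilter, and put the `z`-filter of all zero sets
through `p` on top. The limits stay distinct because any choice of closed subsets of the `B k`,
together with `p`, is a closed set.

If `p` lies in all `A^{(n)}`, the lengths of the chains may grow with `k`, and the limits along an
ultrafilter `U` form chains of the order type of any suborder of an ultraproduct of finite chains
over `U`. Every linear order `L` of cardinality at most the continuum is such a suborder for a
suitable `U`: realise `L` as a set of binary sequences; any finite subset of `L` is separated by
initial segments of some length, so it is mapped into a finite chain in a strictly increasing way
by a function of such initial segments, and there are only countably many functions of this kind.
-/

open Filter Function Set Topology
open CantorBendixson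
open scoped Cardinal

section ZeroSets

variable {X : Type*} [TopologicalSpace X] {Z W : Set X}

theorem univ_mem_zeroSets : univ ∈ zeroSets X :=
  ⟨0, by simp⟩

theorem empty_mem_zeroSets : ∅ ∈ zeroSets X :=
  ⟨1, by simp⟩

theorem inter_mem_zeroSets (hZ : Z ∈ zeroSets X) (hW : W ∈ zeroSets X) : Z ∩ W ∈ zeroSets X := by
  obtain ⟨f, rfl⟩ := hZ
  obtain ⟨g, rfl⟩ := hW
  refine ⟨f * f + g * g, ?_⟩
  ext x
  exact mul_self_add_mul_self_eq_zero.symm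

theorem isClosed_of_mem_zeroSets (hZ : Z ∈ zeroSets X) : IsClosed Z := by
  obtain ⟨f, rfl⟩ := hZ
  exact isClosed_eq f.continuous continuous_const

theorem mem_zeroSets_iff_isClosed [PerfectlyNormalSpace X] : Z ∈ zeroSets X ↔ IsClosed Z := by
  refine ⟨isClosed_of_mem_zeroSets, fun hZ => ?_⟩
  obtain ⟨f, hf, -⟩ := perfectlyNormalSpace_iff_forall_isClosed_preimage_zero.1 ‹_› Z hZ
  exact ⟨f, hf⟩

end ZeroSets

section ZFilters

variable {X : Type*} [TopologicalSpace X] {F G P : Set (Set X)} {Z W : Set X}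

namespace IsZFilter

theorem mem_zeroSets (hF : IsZFilter F) (hZ : Z ∈ F) : Z ∈ zeroSets X :=
  hF.proper.subset hZ

theorem univ_mem (hF : IsZFilter F) : univ ∈ F :=
  have ⟨Z, hZ⟩ := hF.nonempty
  hF.superset_mem Z hZ univ univ_mem_zeroSets (subset_univ Z)

theorem empty_notMem (hF : IsZFilter F) : ∅ ∉ F := fun h =>
  hF.proper.not_subset fun Z hZ => hF.superset_mem ∅ h Z hZ (empty_subset Z)

theorem not_disjoint (hF : IsZFilter F) (hZ : Z ∈ F) (hW : W ∈ F) : ¬Disjoint Z W := fun h =>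
  hF.empty_notMem (h.inter_eq ▸ hF.inter_mem Z hZ W hW)

theorem exists_subset_of_ssubset (hF : IsZFilter F) (hG : IsZFilter G) (hGF : G ⊂ F)
    (hW : W ∈ G) : ∃ Z ⊆ W, Z ∈ F ∧ Z ∉ G := by
  obtain ⟨Z, hZF, hZG⟩ := exists_of_ssubset hGF
  refine ⟨Z ∩ W, inter_subset_right, hF.inter_mem Z hZF W (hGF.subset hW), fun h => hZG ?_⟩
  exact hG.superset_mem _ h Z (hF.mem_zeroSets hZF) inter_subset_left

end IsZFilter

theorem IsPrimeZFilter.mem_or_mem (hP : IsPrimeZFilter P) (hZ : Z ∈ zeroSets X)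
    (hW : W ∈ zeroSets X) (h : Z ∪ W ∈ P) : Z ∈ P ∨ W ∈ P := by
  by_contra! hn
  exact hP.union_notMem Z ⟨hZ, hn.1⟩ W ⟨hW, hn.2⟩ h

/-- The fixed `z`-filter at `x`: all zero sets that contain `x`. -/
def pointZFilter (x : X) : Set (Set X) :=
  {Z ∈ zeroSets X | x ∈ Z}

theorem isPrimeZFilter_pointZFilter (x : X) : IsPrimeZFilter (pointZFilter x) where
  nonempty := ⟨univ, univ_mem_zeroSets, mem_univ x⟩
  proper := ⟨sep_subset _ _, fun h => (h empty_mem_zeroSets).2⟩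
  inter_mem _ hZ _ hW := ⟨inter_mem_zeroSets hZ.1 hW.1, hZ.2, hW.2⟩
  superset_mem _ hZ _ hW hZW := ⟨hW, hZW hZ.2⟩
  union_notMem _ hZ _ hW h := h.2.elim (fun hx => hZ.2 ⟨hZ.1, hx⟩) fun hx => hW.2 ⟨hW.1, hx⟩

/-- The limit of a family of `z`-filters along a filter `U` on the index set: the sets that belong
to `U`-almost all members of the family. It is mainly of interest when `U` is an ultrafilter. -/
def zLimit {ι : Type*} (U : Filter ι) (P : ι → Set (Set X)) : Set (Set X) :=
  {Z | ∀ᶠ i in U, Z ∈ P i}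

theorem isZFilter_zLimit {ι : Type*} {U : Filter ι} [U.NeBot] {P : ι → Set (Set X)}
    (hP : ∀ i, IsZFilter (P i)) : IsZFilter (zLimit U P) where
  nonempty := ⟨univ, .of_forall fun i => (hP i).univ_mem⟩
  proper := by
    refine ⟨fun Z hZ => ?_, fun h => ?_⟩
    · obtain ⟨i, hi⟩ := Eventually.exists hZ
      exact (hP i).mem_zeroSets hi
    · obtain ⟨i, hi⟩ := Eventually.exists (h empty_mem_zeroSets)
      exact (hP i).empty_notMem hi
  inter_mem Z hZ W hW := by
    filter_upwards [hZ, hW] with i hZi hWi using (hP i).inter_mem Z hZi W hWi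
  superset_mem Z hZ W hW hZW := by
    filter_upwards [hZ] with i hZi using (hP i).superset_mem Z hZi W hW hZW

theorem isPrimeZFilter_zLimit {ι : Type*} (U : Ultrafilter ι) {P : ι → Set (Set X)}
    (hP : ∀ i, IsPrimeZFilter (P i)) : IsPrimeZFilter (zLimit U P) where
  toIsZFilter := isZFilter_zLimit fun i => (hP i).toIsZFilter
  union_notMem Z hZ W hW h := by
    have hZW : ∀ᶠ i in (U : Filter ι), Z ∈ P i ∨ W ∈ P i :=
      Eventually.mono h fun i => (hP i).mem_or_mem hZ.1 hW.1
    exact (Ultrafilter.eventually_or.1 hZW).elim hZ.2 hW.2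

end ZFilters

section Shrinking

variable {X : Type*} [TopologicalSpace X] {ι : Type*} {p : X}

/-- The sets `B i` are closed, pairwise disjoint, avoid `p`, and shrink to `p`: every neighbourhood
of `p` contains all but finitely many of them. -/
structure ShrinksTo (B : ι → Set X) (p : X) : Prop where
  isClosed : ∀ i, IsClosed (B i)
  notMem : ∀ i, p ∉ B i
  pairwise_disjoint : Pairwise (Disjoint on B)
  tendsto : Tendsto B cofinite (𝓝 p).smallSets

theorem isClosed_insert_iUnion_of_tendsto_smallSets [T2Space X] {Z : ι → Set X}
    (hZ : ∀ i, IsClosed (Z i)) (hp : Tendsto Z cofinite (𝓝 p).smallSets) :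
    IsClosed (insert p (⋃ i, Z i)) := by
  refine isOpen_compl_iff.1 (isOpen_iff_mem_nhds.2 fun y hy => ?_)
  simp only [mem_compl_iff, mem_insert_iff, mem_iUnion, not_or, not_exists] at hy
  obtain ⟨u, v, hu, hv, huv⟩ := t2_separation_nhds hy.1
  have hfin : {i | ¬Z i ⊆ v}.Finite := tendsto_smallSets_iff.1 hp v hv
  have hclosed : IsClosed (⋃ i ∈ {i | ¬Z i ⊆ v}, Z i) := hfin.isClosed_biUnion fun i _ => hZ i
  have hy' : y ∉ ⋃ i ∈ {i | ¬Z i ⊆ v}, Z i := by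
    simpa only [mem_iUnion₂, not_exists] using fun i _ => hy.2 i
  filter_upwards [hu, hclosed.compl_mem_nhds hy'] with z hzu hz
  rintro (rfl | hzZ)
  · exact huv.notMem_of_mem_left hzu (mem_of_mem_nhds hv)
  · obtain ⟨i, hi⟩ := mem_iUnion.1 hzZ
    exact hz (mem_biUnion (fun hiv => huv.notMem_of_mem_left hzu (hiv hi)) hi)

theorem ShrinksTo.exists_isClosed_inter_eq [T2Space X] {B : ι → Set X} (hB : ShrinksTo B p)
    {Z : ι → Set X} (hZ : ∀ i, IsClosed (Z i)) (hZB : ∀ i, Z i ⊆ B i) :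
    ∃ W, IsClosed W ∧ ∀ i, W ∩ B i = Z i := by
  refine ⟨insert p (⋃ i, Z i), isClosed_insert_iUnion_of_tendsto_smallSets hZ
    (hB.tendsto.smallSets_mono (.of_forall hZB)), fun i => Subset.antisymm ?_ ?_⟩
  · rintro y ⟨rfl | hy, hyB⟩
    · exact absurd hyB (hB.notMem i)
    · obtain ⟨j, hj⟩ := mem_iUnion.1 hy
      obtain rfl : j = i := by
        by_contra hji
        exact (hB.pairwise_disjoint hji).notMem_of_mem_left (hZB j hj) hyB
      exact hj
  · exact subset_inter ((subset_iUnion Z i).trans (subset_insert p _)) (hZB i)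

theorem exists_isClosed_nhds_subset_of_mem_derivedSet [T3Space X] {A V : Set X}
    (hp : p ∈ derivedSet A) (hV : V ∈ 𝓝 p) :
    ∃ B ⊆ V, IsClosed B ∧ p ∉ B ∧ ∃ x ∈ A, B ∈ 𝓝 x := by
  obtain ⟨x, ⟨hxV, hxA⟩, hxp⟩ := accPt_iff_nhds.1 hp _ (interior_mem_nhds.2 hV)
  have hx : V \ {p} ∈ 𝓝 x :=
    inter_mem (mem_interior_iff_mem_nhds.1 hxV) (compl_singleton_mem_nhds hxp)
  obtain ⟨B, hBx, hB, hBV⟩ := exists_mem_nhds_isClosed_subset hx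
  exact ⟨B, hBV.trans sdiff_subset, hB, fun hpB => (hBV hpB).2 rfl, x, hxA, hBx⟩

theorem exists_shrinksTo_of_mem_derivedSet [T3Space X] [FirstCountableTopology X] {A : ℕ → Set X}
    (hp : ∀ n, p ∈ derivedSet (A n)) :
    ∃ B : ℕ → Set X, ShrinksTo B p ∧ ∀ n, ∃ x ∈ A n, B n ∈ 𝓝 x := by
  obtain ⟨V, hV⟩ := (𝓝 p).exists_antitone_basis
  choose C hCV hC hpC x hxA hxC using fun n (N : {N // N ∈ 𝓝 p}) =>
    exists_isClosed_nhds_subset_of_mem_derivedSet (hp n) (inter_mem N.2 (hV.mem n))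
  let N : ℕ → {N // N ∈ 𝓝 p} := Nat.rec ⟨univ, univ_mem⟩ fun n N =>
    ⟨N ∩ (C n N)ᶜ, inter_mem N.2 ((hC n N).compl_mem_nhds (hpC n N))⟩
  have hN : Antitone fun n : ℕ => (N n).1 := antitone_nat_of_succ_le fun _ => inter_subset_left
  have hdisj : Pairwise (Disjoint on fun n => C n (N n)) := by
    refine (pairwise_disjoint_on _).2 fun m n hmn => disjoint_left.2 fun y hym hyn => ?_
    have hy : y ∈ (N (m + 1) : Set X) := hN hmn (hCV n (N n) hyn).1
    exact hy.2 hym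
  have hlim : Tendsto (fun n => C n (N n)) cofinite (𝓝 p).smallSets := by
    rw [Nat.cofinite_eq_atTop]
    exact hV.tendsto_smallSets.smallSets_mono
      (.of_forall fun n => (hCV n (N n)).trans inter_subset_right)
  exact ⟨fun n => C n (N n), ⟨fun n => hC n (N n), fun n => hpC n (N n), hdisj, hlim⟩,
    fun n => ⟨x n (N n), hxA n (N n), hxC n (N n)⟩⟩

end Shrinking

section Limits

variable {X : Type*} [TopologicalSpace X] [T6Space X] {ι : Type*} {B : ι → Set X} {p : X}
  {U : Filter ι} [U.NeBot] {P Q : ι → Set (Set X)}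

theorem ShrinksTo.zLimit_ssubset_zLimit (hB : ShrinksTo B p) (hP : ∀ i, IsZFilter (P i))
    (hQ : ∀ i, IsZFilter (Q i)) (hBQ : ∀ i, B i ∈ Q i) (hQP : ∀ᶠ i in U, Q i ⊂ P i) :
    zLimit U Q ⊂ zLimit U P := by
  refine ⟨fun Z hZ => ?_, fun hPQ => ?_⟩
  · filter_upwards [hQP, hZ] with i hi hZi using hi.subset hZi
  have hex (i) : ∃ Z ⊆ B i, IsClosed Z ∧ (Q i ⊂ P i → Z ∈ P i ∧ Z ∉ Q i) := by
    by_cases hi : Q i ⊂ P i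
    · obtain ⟨Z, hZB, hZP, hZQ⟩ := (hP i).exists_subset_of_ssubset (hQ i) hi (hBQ i)
      exact ⟨Z, hZB, isClosed_of_mem_zeroSets ((hP i).mem_zeroSets hZP), fun _ => ⟨hZP, hZQ⟩⟩
    · exact ⟨∅, empty_subset _, isClosed_empty, fun h => absurd h hi⟩
  choose Z hZB hZ hZPQ using hex
  obtain ⟨W, hW, hWB⟩ := hB.exists_isClosed_inter_eq hZ hZB
  have hWP : W ∈ zLimit U P := by
    filter_upwards [hQP] with i hi
    exact (hP i).superset_mem (Z i) (hZPQ i hi).1 W (mem_zeroSets_iff_isClosed.2 hW)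
      (hWB i ▸ inter_subset_left)
  obtain ⟨i, hi, hWQ⟩ := (hQP.and (hPQ hWP)).exists
  exact (hZPQ i hi).2 (hWB i ▸ (hQ i).inter_mem W hWQ (B i) (hBQ i))

theorem ShrinksTo.zLimit_ssubset_pointZFilter (hB : ShrinksTo B p) (hU : U ≤ cofinite)
    (hP : ∀ i, IsZFilter (P i)) (hBP : ∀ i, B i ∈ P i) : zLimit U P ⊂ pointZFilter p := by
  refine ⟨fun Z hZ => ?_, fun h => ?_⟩
  · have hZ₀ : Z ∈ zeroSets X := (isZFilter_zLimit hP).mem_zeroSets hZ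
    refine ⟨hZ₀, by_contra fun hpZ => ?_⟩
    have hBZ : ∀ᶠ i in U, B i ⊆ Zᶜ := tendsto_smallSets_iff.1 (hB.tendsto.mono_left hU) _
      ((isClosed_of_mem_zeroSets hZ₀).compl_mem_nhds hpZ)
    obtain ⟨i, hi, hZi⟩ := (hBZ.and hZ).exists
    exact (hP i).not_disjoint (hBP i) hZi (disjoint_left.2 hi)
  · have hp : {p} ∈ pointZFilter p :=
      ⟨mem_zeroSets_iff_isClosed.2 isClosed_singleton, mem_singleton p⟩
    obtain ⟨i, hi⟩ := Eventually.exists (h hp)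
    exact (hP i).not_disjoint hi (hBP i) (disjoint_singleton_left.2 (hB.notMem i))

end Limits

section FiniteChains

variable {X : Type*} [TopologicalSpace X] {A C : Set X}

theorem inter_mem_pointZFilter_of_mem_iteratedDerivedSet [PerfectlyNormalSpace X] {p : X}
    {a : Ordinal} (hA : IsClosed A) (hp : p ∈ Aᵈ[a]) (hC : IsClosed C) (hpC : p ∈ C) :
    A ∩ C ∈ pointZFilter p := by
  refine ⟨mem_zeroSets_iff_isClosed.2 (hA.inter hC), ?_, hpC⟩
  simpa only [iteratedDerivedSet_zero] using iteratedDerivedSet_antitone A zero_le hp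

theorem exists_fin_strictAnti_isPrimeZFilter [T6Space X] [FirstCountableTopology X] {n : ℕ}
    {p : X} (hA : IsClosed A) (hp : p ∈ Aᵈ[n]) (hC : IsClosed C) (hpC : C ∈ 𝓝 p) :
    ∃ P : Fin (n + 1) → Set (Set X), StrictAnti P ∧ ∀ i, IsPrimeZFilter (P i) ∧ A ∩ C ∈ P i := by
  induction n generalizing p C with
  | zero =>
    have hACp :=
      inter_mem_pointZFilter_of_mem_iteratedDerivedSet hA hp hC (mem_of_mem_nhds hpC)
    exact ⟨fun _ => pointZFilter p, Subsingleton.strictAnti (α := Fin 1) _,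
      fun _ => ⟨isPrimeZFilter_pointZFilter p, hACp⟩⟩
  | succ n ih =>
    have hACp :=
      inter_mem_pointZFilter_of_mem_iteratedDerivedSet hA hp hC (mem_of_mem_nhds hpC)
    rw [Nat.cast_succ, iteratedDerivedSet_succ] at hp
    obtain ⟨B, hB, hBA⟩ := exists_shrinksTo_of_mem_derivedSet fun _ : ℕ => hp.1
    choose x hxA hBx using hBA
    choose P hP hPprime hPA using fun k => ih (hxA k) (hB.isClosed k) (hBx k)
    have hBP (k i) : B k ∈ P k i := (hPprime k i).superset_mem _ (hPA k i) _
      (mem_zeroSets_iff_isClosed.2 (hB.isClosed k)) inter_subset_right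
    let Q (i : Fin (n + 1)) : Set (Set X) := zLimit (hyperfilter ℕ) fun k => P k i
    have hACQ (i) : A ∩ C ∈ Q i := by
      have hBC : ∀ᶠ k in hyperfilter ℕ, B k ⊆ C :=
        tendsto_smallSets_iff.1 (hB.tendsto.mono_left hyperfilter_le_cofinite) C hpC
      filter_upwards [hBC] with k hk
      exact (hPprime k i).superset_mem _ (hPA k i) _ hACp.1 (inter_subset_inter_right A hk)
    have hQ : StrictAnti Q := fun i j hij => hB.zLimit_ssubset_zLimit
      (fun k => (hPprime k i).toIsZFilter) (fun k => (hPprime k j).toIsZFilter)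
      (fun k => hBP k j) (.of_forall fun k => hP k hij)
    have hQp : Q 0 ⊂ pointZFilter p := hB.zLimit_ssubset_pointZFilter hyperfilter_le_cofinite
      (fun k => (hPprime k 0).toIsZFilter) fun k => hBP k 0
    exact ⟨Matrix.vecCons (pointZFilter p) Q, hQ.vecCons hQp,
      Fin.cases ⟨isPrimeZFilter_pointZFilter p, hACp⟩ fun i =>
        ⟨isPrimeZFilter_zLimit _ fun k => hPprime k i, hACQ i⟩⟩

end FiniteChains

section FiniteChainEmbeddings

theorem exists_injOn_initialSegment {L α : Type*} {φ : L → ℕ → α} (hφ : Injective φ)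
    (s : Finset L) : ∃ l : ℕ, InjOn (fun a (i : Fin l) => φ a i) s := by
  have hsep (a c : L) : ∀ᶠ l in atTop, (∀ i : Fin l, φ a i = φ c i) → a = c := by
    by_cases hac : a = c
    · exact .of_forall fun _ _ => hac
    · obtain ⟨i, hi⟩ := ne_iff.1 (hφ.ne hac)
      filter_upwards [eventually_gt_atTop i] with l hl h
      exact absurd (h ⟨i, hl⟩) hi
  have hs : ∀ᶠ l in atTop, ∀ a ∈ s, ∀ c ∈ s, (∀ i : Fin l, φ a i = φ c i) → a = c :=
    (eventually_all_finset s).2 fun a _ => (eventually_all_finset s).2 fun c _ => hsep a c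
  obtain ⟨l, hl⟩ := hs.exists
  exact ⟨l, fun a ha c hc h => hl a ha c hc (congrFun h)⟩

theorem exists_fin_strictMonoOn_comp {L T : Type*} [LinearOrder L] {s : Finset L} {r : L → T}
    (hr : InjOn r s) : ∃ (k : ℕ) (g : T → Fin (k + 1)), StrictMonoOn (g ∘ r) s := by
  classical
  let below (t : T) : Finset L := {c ∈ s | ∃ a ∈ s, r a = t ∧ c < a}
  have hbelow {a c : L} (ha : a ∈ s) : c ∈ below (r a) ↔ c ∈ s ∧ c < a := by
    refine Finset.mem_filter.trans (and_congr_right fun _ => ⟨?_, fun h => ⟨a, ha, rfl, h⟩⟩)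
    rintro ⟨a', ha', hr', hca'⟩
    exact hr ha' ha hr' ▸ hca'
  refine ⟨s.card, fun t => ⟨(below t).card, Nat.lt_succ_of_le (Finset.card_filter_le _ _)⟩,
    fun a ha c hc hac => Finset.card_lt_card (Finset.ssubset_iff_of_subset ?_ |>.2 ?_)⟩
  · exact fun d hd => (hbelow hc).2 (((hbelow ha).1 hd).imp_right hac.trans')
  · exact ⟨a, (hbelow hc).2 ⟨ha, hac⟩, fun h => ((hbelow ha).1 h).2.false⟩

theorem exists_nat_fin_strictMonoOn {L : Type*} [LinearOrder L] (hL : #L ≤ 𝔠) :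
    ∃ (b : ℕ → ℕ) (f : ∀ n, L → Fin (b n + 1)), ∀ s : Finset L, ∃ n, StrictMonoOn (f n) s := by
  obtain ⟨φ⟩ : Nonempty (L ↪ (ℕ → Bool)) := Cardinal.lift_mk_le'.1 (by simpa using hL)
  obtain ⟨e, he⟩ := exists_surjective_nat (Σ l k : ℕ, (Fin l → Bool) → Fin (k + 1))
  refine ⟨fun n => (e n).2.1, fun n a => (e n).2.2 fun i => φ a i, fun s => ?_⟩
  obtain ⟨l, hl⟩ := exists_injOn_initialSegment φ.injective s
  obtain ⟨k, g, hg⟩ := exists_fin_strictMonoOn_comp hl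
  obtain ⟨n, hn⟩ := he ⟨l, k, g⟩
  refine ⟨n, ?_⟩
  beta_reduce
  rw [hn]
  exact hg

theorem exists_ultrafilter_eventually_lt {L ι : Type*} [Preorder L] {M : ι → Type*}
    [∀ i, Preorder (M i)] {f : ∀ i, L → M i} (hf : ∀ s : Finset L, ∃ i, StrictMonoOn (f i) s) :
    ∃ U : Ultrafilter ι, ∀ a c, a < c → ∀ᶠ i in U, f i a < f i c := by
  classical
  choose i hi using hf
  refine ⟨(Ultrafilter.of atTop).map i, fun a c hac => Ultrafilter.of_le atTop ?_⟩
  filter_upwards [eventually_ge_atTop {a, c}] with s hs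
  exact hi s (hs (by simp)) (hs (by simp)) hac

end FiniteChainEmbeddings

section Chains

variable {X : Type*} [TopologicalSpace X] {A : Set X}

theorem mem_derivedSet_of_mem_derivedLevelInfty {p : X} (hp : p ∈ derivedLevelInfty A) (n : ℕ) :
    p ∈ derivedSet Aᵈ[n] := by
  have hpn := mem_iInter.1 hp n
  rw [Nat.cast_succ, iteratedDerivedSet_succ] at hpn
  exact hpn.1

variable [T6Space X] [FirstCountableTopology X]

theorem exists_strictAnti_isPrimeZFilter (hA : IsClosed A) (hinf : (derivedLevelInfty A).Nonempty)
    {L : Type*} [LinearOrder L] (hL : #L ≤ 𝔠) :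
    ∃ Q : L → Set (Set X), StrictAnti Q ∧ ∀ a, IsPrimeZFilter (Q a) ∧ A ∈ Q a := by
  obtain ⟨p, hp⟩ := hinf
  obtain ⟨b, f, hf⟩ := exists_nat_fin_strictMonoOn hL
  obtain ⟨U, hU⟩ := exists_ultrafilter_eventually_lt hf
  obtain ⟨B, hB, hBA⟩ :=
    exists_shrinksTo_of_mem_derivedSet fun n => mem_derivedSet_of_mem_derivedLevelInfty hp (b n)
  choose x hxA hBx using hBA
  choose P hP hPprime hPA using fun n =>
    exists_fin_strictAnti_isPrimeZFilter hA (hxA n) (hB.isClosed n) (hBx n)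
  have hAP (n i) : A ∈ P n i := (hPprime n i).superset_mem _ (hPA n i) _
    (mem_zeroSets_iff_isClosed.2 hA) inter_subset_left
  have hBP (n i) : B n ∈ P n i := (hPprime n i).superset_mem _ (hPA n i) _
    (mem_zeroSets_iff_isClosed.2 (hB.isClosed n)) inter_subset_right
  refine ⟨fun a => zLimit U fun n => P n (f n a), fun a c hac => ?_, fun a =>
    ⟨isPrimeZFilter_zLimit U fun n => hPprime n (f n a), .of_forall fun n => hAP n (f n a)⟩⟩
  exact hB.zLimit_ssubset_zLimit (fun n => (hPprime n (f n a)).toIsZFilter)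
    (fun n => (hPprime n (f n c)).toIsZFilter) (fun n => hBP n (f n c))
    ((hU a c hac).mono fun n hn => hP n hn)

theorem mainTheorem9_general (hA : IsClosed A) (hinf : (derivedLevelInfty A).Nonempty)
    {L : Type*} [LinearOrder L] (hL : #L ≤ 𝔠) :
    (∃ Q : L → Set (Set X), StrictAnti Q ∧ ∀ a, IsPrimeZFilter (Q a) ∧ A ∈ Q a) ∧
    (∃ Q : L → Set (Set X), StrictMono Q ∧ ∀ a, IsPrimeZFilter (Q a) ∧ A ∈ Q a) := by
  refine ⟨exists_strictAnti_isPrimeZFilter hA hinf hL, ?_⟩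
  obtain ⟨Q, hQ, hQA⟩ := exists_strictAnti_isPrimeZFilter hA hinf (L := Lᵒᵈ) hL
  exact ⟨Q ∘ OrderDual.toDual, fun _ _ hac => hQ hac, fun a => hQA _⟩

end Chains

theorem mainTheorem9 (Δ : Set ℝ) (hcount : Δ.Countable) (hcomp : IsCompact Δ)
    (hinf : (derivedLevelInfty Δ).Nonempty) :
    (∃ Q : Set.Iio (Cardinal.continuum.{0}.ord) → Set (Set ℝ),
      IsDecreasingPrimeZChain Q ∧ ∀ α, Δ ∈ Q α) ∧
    (∃ Q : Set.Iio (Cardinal.continuum.{0}.ord) → Set (Set ℝ),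
      IsIncreasingPrimeZChain Q ∧ ∀ α, Δ ∈ Q α) := by
  have hcard : #(Set.Iio (Cardinal.continuum.{0}.ord)) ≤ 𝔠 := by simp
  obtain ⟨⟨Q, hQ, hQΔ⟩, R, hR, hRΔ⟩ := mainTheorem9_general hcomp.isClosed hinf hcard
  exact ⟨⟨Q, ⟨fun α => (hQΔ α).1, hQ⟩, fun α => (hQΔ α).2⟩,
    R, ⟨fun α => (hRΔ α).1, hR⟩, fun α => (hRΔ α).2⟩
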